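/- For positive integers $n$ and $a$, let $X(n,a)=\{(x,y)\in\mathbb Z\times\mathbb Z : x^2+ay^2=n\}$, let $\tau(n)$ denote the number of positive divisors of $n$, and let $(\,\cdot\,|3)$ denote the Legendre symbol modulo $3$. Let $n$ be a positive integer. Then $X(n,27)$ and $X(n,3)$ are finite, and the following hold. (a) If $3\mid n$, then $X(n,27)\neq\emptyset$ only if $9\mid n$. If $9\mid n$, then $X(n/9,3)$ is finite and $$|X(n,27)|=|X(n/9,3)|.$$ (b) If $3\nmid n$ and $2\mid n$, then $$|X(n,27)|=\tfrac13\,|X(n,3)|.$$ (c) If $\gcd(6,n)=1$, then $$|X(n,27)|=\frac13\left[1+2\cdot\frac{(\tau(n_q)|3)}{\tau(n_q)}\right]\cdot|X(n,3)|,$$ where $n_q$ denotes the product of all prime factors $q$ of $n$, counted with multiplicity, such that $q\equiv1\pmod 3$ and $2$ is not a cubic residue modulo $q$ (that is, $x^3\equiv2\pmod q$ has no integer solution); the empty product is $1$. -/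

import Mathlib

/-- `X(n,a)`: the set of integral solutions of `x² + a y² = n`. -/
def reprSet (n a : ℕ) : Set (ℤ × ℤ) :=
  {v | v.1 ^ 2 + (a : ℤ) * v.2 ^ 2 = (n : ℤ)}

/-- `a` is a cubic residue modulo `m`: the congruence `x³ ≡ a (mod m)` is solvable in integers. -/
def IsCubicResidue (a : ℤ) (m : ℕ) : Prop :=
  ∃ x : ℤ, x ^ 3 ≡ a [ZMOD (m : ℤ)]

open Classical in
/-- `n_q`: the product, with multiplicity, of all prime factors `q` of `n` with `q ≡ 1 (mod 3)` such
that `2` is not a cubic residue modulo `q`. -/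
noncomputable def nonCubicPart (n : ℕ) : ℕ :=
  ∏ q ∈ n.primeFactors with (q ≡ 1 [MOD 3] ∧ ¬ IsCubicResidue 2 q), q ^ n.factorization q

/-- `τ(n)`: the number of positive divisors of `n`. -/
def numDivisors (n : ℕ) : ℕ := n.divisors.card

/-! Read `x² + 3y²` as the norm of `x + y√-3`; then `X(n,27)` corresponds to the elements of norm
`n` with `3 ∣ y`. For `3 ∤ n` the slope `y/x mod 3` turns products into sums, so orthogonality of
the characters of `ℤ/3` reduces the count to the sum `S(n)` of `e(slope)` over norm `n`, with `e`
nontrivial.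

For `n` prime to 6, `S` is evaluated one prime power at a time. If `p = αᾱ` and `s` is the slope of
`α`, then `S(p^k m) = U(k) S(m)` with `U(k+2) + U(k) = (e(s) + e(-s)) U(k+1)`. This gives `U(k) =
k+1` if `s = 0` and `(k+1|3)` otherwise; an inert prime gives the same factor for every character.
Comparison with the trivial character produces `(τ(n_q)|3)/τ(n_q)`, once `s = 0` is known to mean
that 2 is a cubic residue mod `p`. That is Gauss's criterion (`exists_norm_eq_prime`), read off from
the Jacobi sum `J(χ,χ)` of a cubic character: it has norm `p`, is `-1` mod 3 and `χ(2)` mod 2.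

For even `n` prime to 3, multiplication by `ω` equidistributes the slopes. For `3 ∣ n`, the
coordinate `x` is a multiple of 3 and a factor 9 cancels. -/

/-- The ring `ℤ[ω]` of Eisenstein integers, with `ω² = -1 - ω`. -/
abbrev Eisenstein : Type := QuadraticAlgebra ℤ (-1) (-1)

namespace Eisenstein

theorem norm_eq (z : Eisenstein) : z.norm = z.re ^ 2 - z.re * z.im + z.im ^ 2 := by
  rw [QuadraticAlgebra.norm_def]; ring

theorem eq_zero_of_norm {z : Eisenstein} (h : z.norm = 0) : z = 0 := by
  rw [norm_eq] at h
  have him : z.im = 0 := by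
    have : z.im ^ 2 = 0 := by nlinarith [sq_nonneg (2 * z.re - z.im), sq_nonneg z.im]
    simpa using this
  have hre : z.re = 0 := by simpa [him] using h
  exact QuadraticAlgebra.ext hre him

instance : NoZeroDivisors Eisenstein where
  eq_zero_or_eq_zero_of_mul_eq_zero {a b} h := by
    have h' : a.norm * b.norm = 0 := by rw [← map_mul, h, QuadraticAlgebra.norm_zero]
    exact (mul_eq_zero.mp h').imp eq_zero_of_norm eq_zero_of_norm

instance : IsDomain Eisenstein := NoZeroDivisors.to_isDomain _

/-- The cube root of unity `ω`. -/
def omega : Eisenstein := ⟨0, 1⟩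

theorem omega_sq : omega ^ 2 = ⟨-1, -1⟩ := by
  rw [sq]; ext <;> simp [omega]

theorem omega_cube : omega ^ 3 = 1 := by
  rw [pow_succ, omega_sq]; ext <;> simp [omega, QuadraticAlgebra.re_one, QuadraticAlgebra.im_one]

theorem omega_ne_one : omega ≠ 1 := by
  intro h
  simpa [omega, QuadraticAlgebra.im_one] using congrArg QuadraticAlgebra.im h

theorem isPrimitiveRoot_omega : IsPrimitiveRoot omega 3 :=
  IsPrimitiveRoot.mk_of_lt _ (by norm_num) omega_cube fun l hl hl' h => by
    interval_cases l
    · exact omega_ne_one (by simpa using h)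
    · simpa [omega_sq, QuadraticAlgebra.im_one] using congrArg QuadraticAlgebra.im h

theorem norm_omega : omega.norm = 1 := by simp [norm_eq, omega]

end Eisenstein

open Eisenstein

/-! ### Cubic characters and their Jacobi sums -/

/-- A generator `g` of `Fˣ` has `χ g` of exact order 3, so `χ (g ^ k) = 1` forces `3 ∣ k`. -/
theorem MulChar.apply_eq_one_iff_of_orderOf_eq_three {F R : Type*} [Field F] [Finite F]
    [CommRing R] [IsDomain R] {χ : MulChar F R} (hχ : orderOf χ = 3) {a : F} (ha : a ≠ 0) :
    χ a = 1 ↔ ∃ b : F, b ^ 3 = a := by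
  have hχ3 : χ ^ 3 = 1 := hχ ▸ pow_orderOf_eq_one χ
  have hcube : ∀ b : F, b ≠ 0 → χ b ^ 3 = 1 := fun b hb => by
    rw [← MulChar.pow_apply' χ (by norm_num), hχ3, MulChar.one_apply hb.isUnit]
  constructor
  · intro h
    obtain ⟨g, hg⟩ := IsCyclic.exists_generator (α := Fˣ)
    have hg1 : χ g ≠ 1 := by
      intro hg1
      have : χ = 1 := by
        ext u
        obtain ⟨k, rfl⟩ := (Subgroup.mem_zpowers_iff).mp (hg u)
        have h1 : χ.toUnitHom g = 1 := by
          ext; simpa [MulChar.coe_toUnitHom] using hg1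
        rw [MulChar.one_apply_coe, ← MulChar.coe_toUnitHom, map_zpow, h1]; simp
      rw [this, orderOf_one] at hχ
      omega
    have hord : orderOf (χ g) = 3 := orderOf_eq_prime (hcube _ g.ne_zero) hg1
    have : ∃ k : ℕ, g ^ k = Units.mk0 a ha := by
      have := mem_powers_iff_mem_zpowers.mpr (hg (Units.mk0 a ha))
      exact this
    obtain ⟨k, hk⟩ := this
    have hk' : (g : F) ^ k = a := by rw [← Units.val_pow_eq_pow_val, hk, Units.val_mk0]
    have hd : 3 ∣ k := by
      rw [← hord, orderOf_dvd_iff_pow_eq_one, ← map_pow, hk', h]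
    obtain ⟨j, rfl⟩ := hd
    exact ⟨(g : F) ^ j, by rw [← pow_mul, mul_comm, hk']⟩
  · rintro ⟨b, rfl⟩
    rw [map_pow]
    exact hcube b fun hb => ha (by simp [hb])

theorem MulChar.exists_cubic_apply_eq_omega_pow {F : Type*} [Field F] [Finite F]
    {χ : MulChar F Eisenstein} (hχ : χ ^ 3 = 1) {a : F} (ha : a ≠ 0) :
    ∃ k < 3, χ a = Eisenstein.omega ^ k := by
  simpa using MulChar.exists_apply_eq_pow hχ isPrimitiveRoot_omega ha

theorem MulChar.cubic_inv_eq_ringHomComp_star {F : Type*} [Field F] [Finite F]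
    {χ : MulChar F Eisenstein} (hχ : χ ^ 3 = 1) :
    χ⁻¹ = χ.ringHomComp (starRingEnd Eisenstein) := by
  symm
  apply eq_inv_of_mul_eq_one_left
  refine MulChar.ext fun u => ?_
  obtain ⟨k, -, hk⟩ := MulChar.exists_cubic_apply_eq_omega_pow hχ u.ne_zero
  rw [MulChar.mul_apply, MulChar.ringHomComp_apply, MulChar.one_apply_coe, starRingEnd_apply,
    mul_comm, ← QuadraticAlgebra.algebraMap_norm_eq_mul_star, hk, map_pow, norm_omega]
  simp

theorem jacobiSum_norm_of_orderOf_eq_three {F : Type*} [Field F] [Fintype F]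
    {χ : MulChar F Eisenstein} (hχ : orderOf χ = 3) :
    (jacobiSum χ χ).norm = Fintype.card F := by
  have hχ3 : χ ^ 3 = 1 := hχ ▸ pow_orderOf_eq_one χ
  have hχ1 : χ ≠ 1 := fun h => by rw [h, orderOf_one] at hχ; omega
  have hχ2 : χ * χ ≠ 1 := fun h => hχ1 <| by
    rw [pow_succ, sq, h, one_mul] at hχ3; exact hχ3
  -- The product formula `J(χ,χ) J(χ⁻¹,χ⁻¹) = |F|` is applied over a field and descends by
  -- injectivity; the second factor is the conjugate of the first.
  let K := FractionRing Eisenstein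
  have hinj : Function.Injective (algebraMap Eisenstein K) := IsFractionRing.injective _ _
  have : CharZero K := charZero_of_injective_algebraMap hinj
  have hchar : ringChar K ≠ ringChar F := by
    rw [ringChar.eq_zero]
    exact (CharP.ringChar_ne_zero_of_finite F).symm
  let φ := χ.ringHomComp (algebraMap Eisenstein K)
  have h1 : φ ≠ 1 := (MulChar.ringHomComp_ne_one_iff hinj).mpr hχ1
  have h2 : φ * φ ≠ 1 := by
    rw [← MulChar.ringHomComp_mul]
    exact (MulChar.ringHomComp_ne_one_iff hinj).mpr hχ2
  have h := jacobiSum_mul_jacobiSum_inv hchar h1 h1 h2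
  rw [show φ = χ.ringHomComp (algebraMap Eisenstein K) from rfl,
    MulChar.ringHomComp_inv, jacobiSum_ringHomComp, jacobiSum_ringHomComp, ← map_mul,
    MulChar.cubic_inv_eq_ringHomComp_star hχ3, jacobiSum_ringHomComp, starRingEnd_apply,
    ← QuadraticAlgebra.algebraMap_norm_eq_mul_star, ← map_natCast (algebraMap Eisenstein K)] at h
  simpa using congrArg QuadraticAlgebra.re (hinj h)

/-- The Jacobi sum is `-1` modulo `(ω - 1)²`, an associate of 3. -/
theorem three_dvd_jacobiSum_add_one {F : Type*} [Field F] [Fintype F]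
    (hF : 3 ∣ Fintype.card F - 1) {χ : MulChar F Eisenstein} (hχ : χ ^ 3 = 1) :
    (3 : Eisenstein) ∣ jacobiSum χ χ + 1 := by
  obtain ⟨z, -, hz⟩ :=
    exists_jacobiSum_eq_neg_one_add (by norm_num) hχ hχ hF isPrimitiveRoot_omega
  refine ⟨-(z * Eisenstein.omega), ?_⟩
  have : (Eisenstein.omega - 1) ^ 2 = -3 * Eisenstein.omega := by
    rw [sub_sq, omega_sq]
    ext <;> simp [Eisenstein.omega, QuadraticAlgebra.re_one, QuadraticAlgebra.im_one,
      QuadraticAlgebra.re_ofNat, QuadraticAlgebra.im_ofNat]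
  rw [hz, this]; ring

/-- The involution `x ↦ 1 - x` pairs equal terms, which cancel mod 2. Its fixed point `1/2`
contributes `χ(2)⁻² = χ(2)`. -/
theorem two_dvd_jacobiSum_sub {F R : Type*} [Field F] [Fintype F] [CommRing R]
    (hF : (2 : F) ≠ 0) {χ : MulChar F R} (hχ : χ ^ 3 = 1) :
    (2 : R) ∣ jacobiSum χ χ - χ 2 := by
  classical
  rw [← Ideal.mem_span_singleton, ← Ideal.Quotient.eq, jacobiSum, map_sum,
    ← Finset.add_sum_erase _ _ (Finset.mem_univ (2⁻¹ : F))]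
  have h2 : (1 : F) - 2⁻¹ = 2⁻¹ := by field_simp; norm_num
  have hval : χ 2⁻¹ * χ (1 - 2⁻¹) = χ 2 := by
    have hcd : χ 2⁻¹ * χ 2 = 1 := by rw [← map_mul, inv_mul_cancel₀ hF, map_one]
    have hd : χ 2 ^ 3 = 1 := by
      rw [← MulChar.pow_apply' χ (by norm_num), hχ, MulChar.one_apply hF.isUnit]
    rw [h2]
    linear_combination (-χ 2⁻¹ ^ 2) * hd + (χ 2⁻¹ * χ 2 + 1) * χ 2 * hcd
  rw [hval]
  simp only [add_eq_left]
  have htwo : (2 : R ⧸ Ideal.span {(2 : R)}) = 0 :=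
    Ideal.Quotient.eq_zero_iff_mem.mpr (Ideal.mem_span_singleton_self 2)
  refine Finset.sum_involution (fun x _ => 1 - x) ?_ ?_ ?_ ?_
  · intro x _
    rw [sub_sub_cancel, mul_comm (χ (1 - x)), ← two_mul, htwo, zero_mul]
  · intro x hx _ h
    refine Finset.ne_of_mem_erase hx (eq_inv_of_mul_eq_one_left ?_)
    linear_combination -h
  · intro x hx
    refine Finset.mem_erase.mpr ⟨fun h => Finset.ne_of_mem_erase hx ?_, Finset.mem_univ _⟩
    rw [← sub_sub_cancel 1 x, h, h2]
  · intro x _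
    exact sub_sub_cancel 1 x

/-! ### Gauss's criterion for the cubic character of 2 -/

theorem isCubicResidue_iff_zmod (a : ℤ) (m : ℕ) :
    IsCubicResidue a m ↔ ∃ b : ZMod m, b ^ 3 = (a : ZMod m) := by
  constructor
  · rintro ⟨x, hx⟩
    exact ⟨x, by exact_mod_cast (ZMod.intCast_eq_intCast_iff _ _ _).mpr hx⟩
  · rintro ⟨b, hb⟩
    obtain ⟨x, rfl⟩ := ZMod.intCast_surjective b
    exact ⟨x, (ZMod.intCast_eq_intCast_iff _ _ _).mp (by exact_mod_cast hb)⟩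

/-- A prime `p ≡ 1 (mod 3)` is `x² + 3y²`, where `3 ∣ y` exactly if `2` is a cubic residue. -/
theorem exists_norm_eq_prime {p : ℕ} (hp : p.Prime) (h3 : p % 3 = 1) :
    ∃ α : ℤ√(-3), α.norm = p ∧ (3 ∣ α.im ↔ IsCubicResidue 2 p) := by
  have := Fact.mk hp
  have hF : 3 ∣ Fintype.card (ZMod p) - 1 := by rw [ZMod.card]; omega
  have h2 : (2 : ZMod p) ≠ 0 := by
    intro h
    have : p ∣ 2 := (ZMod.natCast_eq_zero_iff 2 p).mp (by exact_mod_cast h)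
    have := (Nat.prime_dvd_prime_iff_eq hp Nat.prime_two).mp this
    omega
  obtain ⟨χ, hχ⟩ := MulChar.exists_mulChar_orderOf (ZMod p) hF isPrimitiveRoot_omega
  have hχ3 : χ ^ 3 = 1 := hχ ▸ pow_orderOf_eq_one χ
  have hnorm := jacobiSum_norm_of_orderOf_eq_three hχ
  obtain ⟨⟨r, s⟩, hw⟩ := three_dvd_jacobiSum_add_one hF hχ3
  obtain ⟨⟨t, v⟩, hz⟩ := two_dvd_jacobiSum_sub h2 hχ3
  have hres : IsCubicResidue 2 p ↔ χ 2 = 1 := by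
    rw [isCubicResidue_iff_zmod, MulChar.apply_eq_one_iff_of_orderOf_eq_three hχ h2]
    norm_num
  rw [hres]
  obtain ⟨k, hk, hχ2⟩ := MulChar.exists_cubic_apply_eq_omega_pow hχ3 h2
  have hone : χ 2 = 1 ↔ k = 0 := by
    rw [hχ2, isPrimitiveRoot_omega.pow_eq_one_iff_dvd]
    omega
  rw [hone]
  rw [hχ2] at hz
  generalize jacobiSum χ χ = J at hnorm hw hz
  obtain ⟨a, b⟩ := J
  rw [norm_eq, ZMod.card] at hnorm
  have hre3 := congrArg QuadraticAlgebra.re hw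
  have him3 := congrArg QuadraticAlgebra.im hw
  have hre2 := congrArg QuadraticAlgebra.re hz
  have him2 := congrArg QuadraticAlgebra.im hz
  simp [QuadraticAlgebra.re_one, QuadraticAlgebra.im_one,
    QuadraticAlgebra.re_ofNat, QuadraticAlgebra.im_ofNat] at hre3 him3
  -- For `J = a + bω ≡ ω^k` mod 2, the even one among `b`, `a`, `a - b` (for `k = 0, 1, 2`) is
  -- halved to give the imaginary part, up to sign. As `a ≡ -1` and `b ≡ 0` mod 3, only `k = 0`
  -- makes it a multiple of 3.
  interval_cases k
  · simp [QuadraticAlgebra.re_one, QuadraticAlgebra.im_one,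
      QuadraticAlgebra.re_ofNat, QuadraticAlgebra.im_ofNat] at hre2 him2 hnorm
    refine ⟨⟨a - v, v⟩, ?_, ?_⟩
    · rw [Zsqrtd.norm_def, ← hnorm, him2]; ring
    · simp; omega
  · simp [Eisenstein.omega, QuadraticAlgebra.re_ofNat, QuadraticAlgebra.im_ofNat] at hre2 him2 hnorm
    refine ⟨⟨b - t, -t⟩, ?_, ?_⟩
    · rw [Zsqrtd.norm_def, ← hnorm, hre2]; ring
    · simp; omega
  · simp [omega_sq, QuadraticAlgebra.re_ofNat, QuadraticAlgebra.im_ofNat] at hre2 him2 hnorm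
    refine ⟨⟨-b - (t - v), t - v⟩, ?_, ?_⟩
    · rw [Zsqrtd.norm_def, ← hnorm, show a = 2 * t - 1 by omega, show b = 2 * v - 1 by omega]
      ring
    · simp; omega

/-! ### Norms and slopes in `ℤ[√-3]` -/

theorem finite_setOf_norm_eq (n : ℕ) : {α : ℤ√(-3) | α.norm = n}.Finite := by
  have hinj : Function.Injective fun α : ℤ√(-3) => (α.re, α.im) := fun α β h =>
    Zsqrtd.ext (congrArg Prod.fst h) (congrArg Prod.snd h)
  refine (((Set.finite_Icc (-n : ℤ) n).prod (Set.finite_Icc (-n : ℤ) n)).preimage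
    hinj.injOn).subset fun α hα => ?_
  rw [Set.mem_ofPred_eq, Zsqrtd.norm_def] at hα
  simp only [Set.mem_preimage, Set.mem_prod, Set.mem_Icc]
  refine ⟨⟨?_, ?_⟩, ?_, ?_⟩ <;>
    nlinarith [Int.le_self_sq α.re, Int.le_self_sq (-α.re), Int.le_self_sq α.im,
      Int.le_self_sq (-α.im)]

/-- The elements of norm `n` in `ℤ[√-3]`. -/
noncomputable def normFiber (n : ℕ) : Finset (ℤ√(-3)) := (finite_setOf_norm_eq n).toFinset

@[simp]
theorem mem_normFiber {n : ℕ} {α : ℤ√(-3)} : α ∈ normFiber n ↔ α.norm = n := by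
  simp [normFiber]

/-- The residue of `y / x` modulo `3`, for `α = x + y√-3` of norm prime to `3`. -/
def slopeModThree (α : ℤ√(-3)) : ZMod 3 := (α.re * α.im : ℤ)

theorem slopeModThree_star (α : ℤ√(-3)) : slopeModThree (star α) = -slopeModThree α := by
  simp [slopeModThree]

theorem slopeModThree_natCast (m : ℕ) : slopeModThree (m : ℤ√(-3)) = 0 := by
  simp [slopeModThree]

theorem sq_re_eq_one {α : ℤ√(-3)} (h : ¬ (3 : ℤ) ∣ α.norm) : (α.re : ZMod 3) ^ 2 = 1 := by
  have h0 : (α.re : ZMod 3) ≠ 0 := fun h0 => h <| by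
    obtain ⟨c, hc⟩ := (ZMod.intCast_zmod_eq_zero_iff_dvd α.re 3).mp h0
    rw [Zsqrtd.norm_def]
    exact ⟨c * α.re + α.im * α.im, by rw [hc]; push_cast; ring⟩
  generalize (α.re : ZMod 3) = a at h0
  decide +revert

/-- Mod 3 the product of `a + b√-3` and `c + d√-3` has coordinates `ac` and `ad + bc`, and `a² = c²
= 1`. -/
theorem slopeModThree_mul {α β : ℤ√(-3)} (hα : ¬ (3 : ℤ) ∣ α.norm) (hβ : ¬ (3 : ℤ) ∣ β.norm) :
    slopeModThree (α * β) = slopeModThree α + slopeModThree β := by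
  have h3 : (3 : ZMod 3) = 0 := by decide
  have ha := sq_re_eq_one hα
  have hb := sq_re_eq_one hβ
  simp only [slopeModThree, Zsqrtd.re_mul, Zsqrtd.im_mul]
  push_cast
  linear_combination (β.re * β.im : ZMod 3) * ha + (α.re * α.im : ZMod 3) * hb
    - (α.im * β.im * (α.re * β.im + α.im * β.re) : ZMod 3) * h3

theorem slopeModThree_eq_zero_iff {α : ℤ√(-3)} (h : ¬ (3 : ℤ) ∣ α.norm) : slopeModThree α = 0 ↔ 3 ∣ α.im := by
  have ha : (α.re : ZMod 3) ≠ 0 := fun h0 => by simpa [h0] using sq_re_eq_one h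
  rw [slopeModThree, Int.cast_mul, mul_eq_zero, or_iff_right ha]
  exact ZMod.intCast_zmod_eq_zero_iff_dvd α.im 3

instance : NoZeroDivisors (ℤ√(-3)) where
  eq_zero_or_eq_zero_of_mul_eq_zero {a b} h := by
    have hd : (-3 : ℤ) < 0 := by norm_num
    have h' : a.norm * b.norm = 0 := by rw [← Zsqrtd.norm_mul, h, Zsqrtd.norm_zero]
    simpa [Zsqrtd.norm_eq_zero_iff hd] using h'

instance : IsDomain (ℤ√(-3)) := NoZeroDivisors.to_isDomain _

/-! ### Divisibility by split and inert primes -/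

section prime

variable {p : ℕ} {α β : ℤ√(-3)}

theorem natCast_dvd_zsqrtd_iff : (p : ℤ√(-3)) ∣ β ↔ (p : ℤ) ∣ β.re ∧ (p : ℤ) ∣ β.im := by
  simpa using Zsqrtd.intCast_dvd (p : ℤ) β

theorem natCast_eq_mul_star (hα : α.norm = p) : (p : ℤ√(-3)) = α * star α := by
  rw [← Zsqrtd.norm_eq_mul_conj, hα]; simp

theorem not_dvd_re_of_norm_eq_prime (hp : p.Prime) (hp3 : p ≠ 3) (hα : α.norm = p) :
    ¬ (p : ℤ) ∣ α.re := by
  have hpz := Nat.prime_iff_prime_int.mp hp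
  rw [Zsqrtd.norm_def] at hα
  rintro ⟨c, hc⟩
  have h1 : (p : ℤ) ∣ 3 * (α.im * α.im) := ⟨1 - c * α.re, by linear_combination hα - α.re * hc⟩
  have h2 : (p : ℤ) ∣ α.im := by
    rcases hpz.dvd_or_dvd h1 with h | h
    · exact absurd ((Nat.prime_dvd_prime_iff_eq hp Nat.prime_three).mp (by exact_mod_cast h)) hp3
    · exact (hpz.dvd_or_dvd h).elim id id
  obtain ⟨d, hd⟩ := h2
  have h3 : (p : ℤ) * (p * (c * c + 3 * d * d)) = p * 1 := by
    have := hα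
    rw [hc, hd] at this
    linarith
  exact hpz.not_dvd_one ⟨_, (mul_left_cancel₀ hpz.ne_zero h3).symm⟩

theorem dvd_of_dvd_mul_star (hp : p.Prime) (hα : α.norm = p)
    (h : (p : ℤ√(-3)) ∣ β * star α) : α ∣ β := by
  have h0 : star α ≠ 0 := fun h0 => hp.ne_zero <| by
    have := natCast_eq_mul_star hα
    rw [h0, mul_zero] at this
    exact_mod_cast this
  rw [natCast_eq_mul_star hα] at h
  exact (mul_dvd_mul_iff_right h0).mp h

/-- Unique factorization fails in `ℤ[√-3]`, so this is proved directly: the imaginary parts of `βᾱ`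
and `βα` have product divisible by `p`. If `p` divides one of them, the norm makes it divide the
real part too, and the conjugate factor cancels. -/
theorem dvd_or_star_dvd (hp : p.Prime) (hα : α.norm = p) (hβ : (p : ℤ) ∣ β.norm) :
    α ∣ β ∨ star α ∣ β := by
  have hpz := Nat.prime_iff_prime_int.mp hp
  have key : ∀ γ : ℤ√(-3), γ.norm = p → (p : ℤ) ∣ (β * star γ).im → γ ∣ β := by
    intro γ hγ him
    refine dvd_of_dvd_mul_star hp hγ (natCast_dvd_zsqrtd_iff.mpr ⟨?_, him⟩)
    have hn : (p : ℤ) ∣ (β * star γ).norm := by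
      rw [Zsqrtd.norm_mul]; exact hβ.mul_right _
    rw [Zsqrtd.norm_def] at hn
    have h2 : (p : ℤ) ∣ (β * star γ).re * (β * star γ).re := by
      have h1 := dvd_add hn ((him.mul_right (β * star γ).im).mul_left (-3))
      have h2 : ∀ x y : ℤ, x * x - -3 * y * y + -3 * (y * y) = x * x := fun x y => by ring
      rwa [h2] at h1
    exact (hpz.dvd_or_dvd h2).elim id id
  have hprod : (p : ℤ) ∣ (β * star α).im * (β * star (star α)).im := by
    have : (β * star α).im * (β * star (star α)).im
        = β.im * β.im * α.norm - α.im * α.im * β.norm := by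
      simp only [Zsqrtd.norm_def, Zsqrtd.im_mul, Zsqrtd.re_star, Zsqrtd.im_star]
      ring
    rw [this, hα]
    exact dvd_sub (dvd_mul_left _ _) (hβ.mul_left _)
  exact (hpz.dvd_or_dvd hprod).imp (key α hα) (key (star α) (by rw [Zsqrtd.norm_conj, hα]))

/-- The integer `α + ᾱ = 2 re α` is prime to `p`, while `p = αᾱ` divides `β(α + ᾱ)`. -/
theorem natCast_dvd_of_dvd_of_star_dvd (hp : p.Prime) (hp2 : p ≠ 2) (hp3 : p ≠ 3)
    (hα : α.norm = p) (h1 : α ∣ β) (h2 : star α ∣ β) : (p : ℤ√(-3)) ∣ β := by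
  have hpz := Nat.prime_iff_prime_int.mp hp
  have h : (p : ℤ√(-3)) ∣ β * (2 * α.re : ℤ) := by
    have h3 : ((2 * α.re : ℤ) : ℤ√(-3)) = star α + α := by
      ext
      · simp; ring
      · simp
    rw [h3, mul_add, natCast_eq_mul_star hα]
    refine dvd_add (mul_dvd_mul_right h1 _) ?_
    rw [mul_comm α]
    exact mul_dvd_mul_right h2 _
  have hnd : ¬ (p : ℤ) ∣ 2 * α.re := fun h => by
    rcases hpz.dvd_or_dvd h with h | h
    · exact hp2 ((Nat.prime_dvd_prime_iff_eq hp Nat.prime_two).mp (by exact_mod_cast h))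
    · exact not_dvd_re_of_norm_eq_prime hp hp3 hα h
  rw [natCast_dvd_zsqrtd_iff] at h ⊢
  simp only [Zsqrtd.re_mul, Zsqrtd.im_mul, Zsqrtd.re_intCast, Zsqrtd.im_intCast, mul_zero,
    add_zero, zero_add] at h
  exact ⟨(hpz.dvd_or_dvd h.1).resolve_right hnd, (hpz.dvd_or_dvd h.2).resolve_right hnd⟩

theorem natCast_dvd_of_dvd_norm_of_inert (hp : p.Prime) (hp2 : p ≠ 2) (h3 : p % 3 = 2)
    (hβ : (p : ℤ) ∣ β.norm) : (p : ℤ√(-3)) ∣ β := by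
  have := Fact.mk hp
  have hpz := Nat.prime_iff_prime_int.mp hp
  have h2 : (2 : ZMod p) ≠ 0 := fun h =>
    hp2 ((Nat.prime_dvd_prime_iff_eq hp Nat.prime_two).mp
      ((ZMod.natCast_eq_zero_iff 2 p).mp (by exact_mod_cast h)))
  have h30 : (3 : ZMod p) ≠ 0 := fun h => by
    have := (Nat.prime_dvd_prime_iff_eq hp Nat.prime_three).mp
      ((ZMod.natCast_eq_zero_iff 3 p).mp (by exact_mod_cast h))
    omega
  have hsum : (β.re : ZMod p) ^ 2 + 3 * (β.im : ZMod p) ^ 2 = 0 := by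
    have h := (ZMod.intCast_zmod_eq_zero_iff_dvd _ p).mpr hβ
    rw [Zsqrtd.norm_def] at h
    push_cast at h
    linear_combination h
  have him : (β.im : ZMod p) = 0 := by
    by_contra him
    obtain ⟨w, hw⟩ : ∃ w : ZMod p, w ^ 2 = -3 :=
      ⟨β.re / β.im, by rw [div_pow, div_eq_iff (pow_ne_zero 2 him)]; linear_combination hsum⟩
    -- A square root `w` of `-3` yields the primitive cube root of unity `(w - 1)/2`, forcing `3 ∣ p
    -- - 1`.
    have hord : orderOf ((w - 1) / 2) = 3 := by
      refine orderOf_eq_prime ?_ fun h => ?_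
      · rw [div_pow, div_eq_one_iff_eq (pow_ne_zero 3 h2)]
        linear_combination (w - 3) * hw
      · rw [div_eq_one_iff_eq h2] at h
        have h12 : (2 : ZMod p) * 2 * 3 = 0 := by
          linear_combination hw - (w + 3) * h
        simp [h2, h30] at h12
    have hne : (w - 1) / 2 ≠ 0 := fun h0 => by simp [h0] at hord
    have hdvd := ZMod.orderOf_dvd_card_sub_one hne
    rw [hord] at hdvd
    have := hp.two_le
    omega
  have hre : (β.re : ZMod p) = 0 := by simpa [him] using hsum
  exact natCast_dvd_zsqrtd_iff.mpr ⟨(ZMod.intCast_zmod_eq_zero_iff_dvd _ p).mp hre,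
    (ZMod.intCast_zmod_eq_zero_iff_dvd _ p).mp him⟩

end prime

/-! ### Recurrences for the character sums -/

/-- The sum of the character `e` of the slopeModThree over all elements of norm `n`. -/
noncomputable def slopeSum (e : AddChar (ZMod 3) ℂ) (n : ℕ) : ℂ :=
  ∑ α ∈ normFiber n, e (slopeModThree α)

section recursion

variable (e : AddChar (ZMod 3) ℂ) {p n : ℕ} {α : ℤ√(-3)}

theorem sum_image_mul_normFiber (hα0 : α ≠ 0) (hα : ¬ (3 : ℤ) ∣ α.norm) (hn : ¬ 3 ∣ n) :
    ∑ β ∈ (normFiber n).image (α * ·), e (slopeModThree β) = e (slopeModThree α) * slopeSum e n := by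
  rw [Finset.sum_image ((mul_right_injective₀ hα0).injOn), slopeSum, Finset.mul_sum]
  refine Finset.sum_congr rfl fun β hβ => ?_
  rw [mem_normFiber] at hβ
  rw [slopeModThree_mul hα (by rw [hβ]; exact_mod_cast hn), AddChar.map_add_eq_mul]

theorem mem_image_mul_normFiber {m : ℕ} (hm : m ≠ 0) (hα : α.norm = m) {β : ℤ√(-3)} :
    β ∈ (normFiber n).image (α * ·) ↔ α ∣ β ∧ β.norm = (m * n : ℕ) := by
  simp only [Finset.mem_image, mem_normFiber]
  constructor
  · rintro ⟨γ, hγ, rfl⟩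
    exact ⟨dvd_mul_right _ _, by rw [Zsqrtd.norm_mul, hα, hγ]; push_cast; rfl⟩
  · rintro ⟨⟨γ, rfl⟩, h⟩
    refine ⟨γ, ?_, rfl⟩
    rw [Zsqrtd.norm_mul, hα] at h
    push_cast at h
    exact mul_left_cancel₀ (by exact_mod_cast hm) h

theorem norm_natCast_eq (p : ℕ) : (p : ℤ√(-3)).norm = (p * p : ℕ) := by
  rw [Zsqrtd.norm_natCast]; push_cast; rfl

theorem dvd_of_natCast_dvd (hp : p.Prime) {β : ℤ√(-3)} (h : (p : ℤ√(-3)) ∣ β)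
    (hβ : β.norm = (p * n : ℕ)) : p ∣ n := by
  obtain ⟨γ, rfl⟩ := h
  rw [Zsqrtd.norm_mul, norm_natCast_eq] at hβ
  push_cast at hβ
  rw [mul_assoc] at hβ
  have h' := mul_left_cancel₀ (by exact_mod_cast hp.ne_zero) hβ
  exact Int.natCast_dvd_natCast.mp ⟨_, h'.symm⟩

theorem not_three_dvd_of_prime (hp : p.Prime) (hp3 : p ≠ 3) : ¬ 3 ∣ p := fun h =>
  hp3 ((Nat.prime_dvd_prime_iff_eq Nat.prime_three hp).mp h).symm

/-- Inclusion–exclusion: every element of norm `pn` is a multiple of `α` or of `ᾱ`. -/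
theorem slopeSum_split_add (hp : p.Prime) (hp3 : p ≠ 3) (hα : α.norm = p) (hn : ¬ 3 ∣ n) :
    slopeSum e (p * n) +
      ∑ β ∈ (normFiber n).image (α * ·) ∩ (normFiber n).image (star α * ·), e (slopeModThree β) =
      (e (slopeModThree α) + e (-slopeModThree α)) * slopeSum e n := by
  have hα' : (star α).norm = p := by rw [Zsqrtd.norm_conj, hα]
  have h3p := not_three_dvd_of_prime hp hp3
  have h0 : ∀ γ : ℤ√(-3), γ.norm = p → γ ≠ 0 := by
    rintro γ hγ rfl
    rw [Zsqrtd.norm_zero] at hγ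
    exact hp.ne_zero (by exact_mod_cast hγ.symm)
  have hunion : normFiber (p * n) =
      (normFiber n).image (α * ·) ∪ (normFiber n).image (star α * ·) := by
    ext β
    rw [Finset.mem_union, mem_image_mul_normFiber hp.ne_zero hα,
      mem_image_mul_normFiber hp.ne_zero hα', mem_normFiber, ← or_and_right]
    refine (and_iff_right_of_imp fun h => dvd_or_star_dvd hp hα ?_).symm
    rw [h]; push_cast; exact dvd_mul_right _ _
  rw [slopeSum, hunion, Finset.sum_union_inter,
    sum_image_mul_normFiber e (h0 α hα) (by rw [hα]; exact_mod_cast h3p) hn,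
    sum_image_mul_normFiber e (h0 _ hα') (by rw [hα']; exact_mod_cast h3p) hn, slopeModThree_star,
    add_mul]

theorem slopeSum_split_of_not_dvd (hp : p.Prime) (hp2 : p ≠ 2) (hp3 : p ≠ 3) (hα : α.norm = p)
    (hn : ¬ 3 ∣ n) (hpn : ¬ p ∣ n) :
    slopeSum e (p * n) = (e (slopeModThree α) + e (-slopeModThree α)) * slopeSum e n := by
  have hα' : (star α).norm = p := by rw [Zsqrtd.norm_conj, hα]
  rw [← slopeSum_split_add e hp hp3 hα hn, left_eq_add]
  refine Finset.sum_eq_zero fun β hβ => absurd ?_ hpn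
  rw [Finset.mem_inter, mem_image_mul_normFiber hp.ne_zero hα,
    mem_image_mul_normFiber hp.ne_zero hα'] at hβ
  exact dvd_of_natCast_dvd hp
    (natCast_dvd_of_dvd_of_star_dvd hp hp2 hp3 hα hβ.1.1 hβ.2.1) hβ.1.2

theorem sum_image_natCast_mul (hp : p.Prime) (hp3 : p ≠ 3) (hn : ¬ 3 ∣ n) :
    ∑ β ∈ (normFiber n).image ((p : ℤ√(-3)) * ·), e (slopeModThree β) = slopeSum e n := by
  rw [sum_image_mul_normFiber e (by exact_mod_cast hp.ne_zero) _ hn, slopeModThree_natCast,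
    AddChar.map_zero_eq_one, one_mul]
  rw [norm_natCast_eq]
  have := Nat.Prime.dvd_mul Nat.prime_three (m := p) (n := p)
  have h3p := not_three_dvd_of_prime hp hp3
  intro h
  have h' : 3 ∣ p * p := by exact_mod_cast h
  tauto

/-- The common multiples of `α` and `ᾱ` are the multiples of `p`, which has slope 0, so the overlap
contributes the sum at `n`. -/
theorem slopeSum_split_mul_mul (hp : p.Prime) (hp2 : p ≠ 2) (hp3 : p ≠ 3) (hα : α.norm = p)
    (hn : ¬ 3 ∣ n) :
    slopeSum e (p * (p * n)) + slopeSum e n =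
      (e (slopeModThree α) + e (-slopeModThree α)) * slopeSum e (p * n) := by
  have hα' : (star α).norm = p := by rw [Zsqrtd.norm_conj, hα]
  have h3p := not_three_dvd_of_prime hp hp3
  have h3pn : ¬ 3 ∣ p * n := by rw [Nat.prime_three.dvd_mul]; tauto
  rw [← slopeSum_split_add e hp hp3 hα h3pn, ← sum_image_natCast_mul e hp hp3 hn]
  congr 2
  ext β
  rw [Finset.mem_inter, mem_image_mul_normFiber hp.ne_zero hα,
    mem_image_mul_normFiber hp.ne_zero hα',
    mem_image_mul_normFiber (mul_ne_zero hp.ne_zero hp.ne_zero) (norm_natCast_eq p), mul_assoc]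
  have hdvd : (p : ℤ√(-3)) ∣ β ↔ α ∣ β ∧ star α ∣ β := by
    refine ⟨fun h => ?_, fun h => natCast_dvd_of_dvd_of_star_dvd hp hp2 hp3 hα h.1 h.2⟩
    rw [natCast_eq_mul_star hα] at h
    exact ⟨(dvd_mul_right _ _).trans h, (dvd_mul_left _ _).trans h⟩
  rw [hdvd]
  tauto

theorem slopeSum_inert_of_not_dvd (hp : p.Prime) (hp2 : p ≠ 2) (h3 : p % 3 = 2)
    (hpn : ¬ p ∣ n) : slopeSum e (p * n) = 0 := by
  refine Finset.sum_eq_zero fun β hβ => absurd ?_ hpn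
  rw [mem_normFiber] at hβ
  refine dvd_of_natCast_dvd hp (natCast_dvd_of_dvd_norm_of_inert hp hp2 h3 ?_) hβ
  rw [hβ]; push_cast; exact dvd_mul_right _ _

theorem slopeSum_inert_mul_mul (hp : p.Prime) (hp2 : p ≠ 2) (h3 : p % 3 = 2) (hn : ¬ 3 ∣ n) :
    slopeSum e (p * (p * n)) = slopeSum e n := by
  rw [← sum_image_natCast_mul e hp (by omega) hn, slopeSum]
  congr 1
  ext β
  rw [mem_image_mul_normFiber (mul_ne_zero hp.ne_zero hp.ne_zero) (norm_natCast_eq p),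
    mem_normFiber, mul_assoc]
  refine (and_iff_right_of_imp fun h => natCast_dvd_of_dvd_norm_of_inert hp hp2 h3 ?_).symm
  rw [h]; push_cast; exact dvd_mul_right _ _

end recursion

/-! ### Values at prime powers -/

section evaluation

variable {e : AddChar (ZMod 3) ℂ} {p m : ℕ} {α : ℤ√(-3)}

theorem not_three_dvd_pow_mul (hp : p.Prime) (hp3 : p ≠ 3) (hm : ¬ 3 ∣ m) (k : ℕ) :
    ¬ 3 ∣ p ^ k * m := fun h =>
  (Nat.prime_three.dvd_mul.mp h).elim
    (fun h => not_three_dvd_of_prime hp hp3 (Nat.prime_three.dvd_of_dvd_pow h)) hm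

theorem slopeSum_split_pow_mul (hp : p.Prime) (hp2 : p ≠ 2) (hp3 : p ≠ 3) (hα : α.norm = p)
    (hm : ¬ 3 ∣ m) (hpm : ¬ p ∣ m) {U : ℕ → ℂ} (hU0 : U 0 = 1)
    (hU1 : U 1 = e (slopeModThree α) + e (-slopeModThree α))
    (hU : ∀ k, U (k + 2) + U k = U 1 * U (k + 1)) (k : ℕ) :
    slopeSum e (p ^ k * m) = U k * slopeSum e m := by
  induction k using Nat.twoStepInduction with
  | zero => simp [hU0]
  | one => rw [pow_one, hU1, slopeSum_split_of_not_dvd e hp hp2 hp3 hα hm hpm]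
  | more k ih1 ih2 =>
    have h := slopeSum_split_mul_mul e hp hp2 hp3 hα (not_three_dvd_pow_mul hp hp3 hm k)
    have e1 : p * (p ^ k * m) = p ^ (k + 1) * m := by ring
    have e2 : p * (p ^ (k + 1) * m) = p ^ (k + 2) * m := by ring
    rw [e1, e2, ih1, ih2, ← hU1] at h
    linear_combination h - hU k * slopeSum e m

theorem slopeSum_inert_pow_mul (hp : p.Prime) (hp2 : p ≠ 2) (h3 : p % 3 = 2)
    (hm : ¬ 3 ∣ m) (hpm : ¬ p ∣ m) (k : ℕ) :
    slopeSum e (p ^ k * m) = if Even k then slopeSum e m else 0 := by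
  induction k using Nat.twoStepInduction with
  | zero => simp
  | one => simpa using slopeSum_inert_of_not_dvd e hp hp2 h3 hpm
  | more k ih1 _ =>
    rw [show p ^ (k + 2) * m = p * (p * (p ^ k * m)) by ring,
      slopeSum_inert_mul_mul e hp hp2 h3 (not_three_dvd_pow_mul hp (by omega) hm k), ih1]
    simp [Nat.even_add]

theorem AddChar.one_add_apply_add_apply_neg (he : e ≠ 1) (s : ZMod 3) :
    1 + e s + e (-s) = if s = 0 then 3 else 0 := by
  have h := AddChar.sum_eq_zero_of_ne_one he
  rw [show (Finset.univ : Finset (ZMod 3)) = {0, 1, 2} by decide] at h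
  simp [show (1 : ZMod 3) ≠ 2 by decide, show (0 : ZMod 3) ≠ 1 by decide,
    show (0 : ZMod 3) ≠ 2 by decide] at h
  split_ifs with hs
  · simp [hs]; norm_num
  · have : s = 1 ∨ s = 2 := by decide +revert
    rcases this with rfl | rfl
    · rw [show (-1 : ZMod 3) = 2 by decide]; linear_combination h
    · rw [show (-2 : ZMod 3) = 1 by decide]; linear_combination h

theorem legendreSym_three_add_add (a : ℤ) :
    legendreSym 3 a + legendreSym 3 (a + 1) + legendreSym 3 (a + 2) = 0 := by
  simp only [legendreSym]
  push_cast
  generalize (a : ZMod 3) = b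
  decide +revert

/-- Here `e(s) + e(-s) = -1`, and the recurrence has the periodic solution `1, -1, 0, …`, which is
`(k+1|3)`. -/
theorem slopeSum_nonCubic_pow_mul (he : e ≠ 1) (hp : p.Prime) (hp2 : p ≠ 2) (hp3 : p ≠ 3)
    (hα : α.norm = p) (hs : slopeModThree α ≠ 0) (hm : ¬ 3 ∣ m) (hpm : ¬ p ∣ m) (k : ℕ) :
    slopeSum e (p ^ k * m) = legendreSym 3 (k + 1 : ℕ) * slopeSum e m := by
  have h1 : legendreSym 3 (1 + 1 : ℕ) = -1 := by decide
  refine slopeSum_split_pow_mul hp hp2 hp3 hα hm hpm (U := fun k => legendreSym 3 (k + 1 : ℕ))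
    (by simp) ?_ (fun k => ?_) k
  · have h := AddChar.one_add_apply_add_apply_neg he (slopeModThree α)
    rw [if_neg hs] at h
    rw [h1]
    push_cast
    linear_combination -h
  · have h := legendreSym_three_add_add (k + 1 : ℕ)
    simp only [h1]
    have h' : ((legendreSym 3 (k + 1 : ℕ) + legendreSym 3 ((k + 1 : ℕ) + 1) +
      legendreSym 3 ((k + 1 : ℕ) + 2) : ℤ) : ℂ) = 0 := by exact_mod_cast h
    push_cast at h' ⊢
    rw [show (k : ℤ) + 2 + 1 = k + 1 + 2 by ring]
    linear_combination h'

/-- The condition is on `e(s)` rather than `s`, so that the trivial character is covered at every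
split prime. -/
theorem slopeSum_cubic_pow_mul (hp : p.Prime) (hp2 : p ≠ 2) (hp3 : p ≠ 3)
    (hα : α.norm = p) (hs : e (slopeModThree α) = 1) (hm : ¬ 3 ∣ m) (hpm : ¬ p ∣ m) (k : ℕ) :
    slopeSum e (p ^ k * m) = (k + 1 : ℕ) * slopeSum e m := by
  refine slopeSum_split_pow_mul hp hp2 hp3 hα hm hpm (U := fun k => (k + 1 : ℕ))
    (by simp) ?_ (fun k => ?_) k
  · rw [AddChar.map_neg_eq_inv, hs]; norm_num
  · push_cast; ring

end evaluation

/-! ### Multiplicativity of `n_q` and its divisor count -/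

section nonCubicPart

variable {p m k : ℕ}

theorem nonCubicPart_one : nonCubicPart 1 = 1 := by simp [nonCubicPart]

theorem nonCubicPart_ne_zero : nonCubicPart m ≠ 0 := by
  classical
  unfold nonCubicPart
  exact Finset.prod_ne_zero_iff.mpr fun q hq =>
    pow_ne_zero _ (Nat.prime_of_mem_primeFactors (Finset.mem_filter.mp hq).1).ne_zero

theorem coprime_nonCubicPart (hp : p.Prime) (hpm : ¬ p ∣ m) : p.Coprime (nonCubicPart m) := by
  classical
  unfold nonCubicPart
  refine Nat.Coprime.prod_right fun q hq => Nat.Coprime.pow_right _ ?_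
  have hq' := (Finset.mem_filter.mp hq).1
  refine (Nat.coprime_primes hp (Nat.prime_of_mem_primeFactors hq')).mpr ?_
  rintro rfl
  exact hpm (Nat.dvd_of_mem_primeFactors hq')

open Classical in
theorem nonCubicPart_pow_mul (hp : p.Prime) (hm : m ≠ 0) (hpm : ¬ p ∣ m) (hk : k ≠ 0) :
    nonCubicPart (p ^ k * m) =
      (if p ≡ 1 [MOD 3] ∧ ¬ IsCubicResidue 2 p then p ^ k else 1) * nonCubicPart m := by
  have hpk : p ^ k ≠ 0 := pow_ne_zero k hp.ne_zero
  have hnotin : p ∉ m.primeFactors := fun h => hpm (Nat.dvd_of_mem_primeFactors h)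
  rw [nonCubicPart, nonCubicPart, Finset.prod_filter, Finset.prod_filter,
    Nat.primeFactors_mul hpk hm, Nat.primeFactors_prime_pow hk hp, Finset.singleton_union,
    Finset.prod_insert hnotin, Nat.factorization_mul hpk hm, hp.factorization_pow]
  congr 1
  · simp [Nat.factorization_eq_zero_of_not_dvd hpm]
  · refine Finset.prod_congr rfl fun q hq => ?_
    have hqp : p ≠ q := fun h => hnotin (h ▸ hq)
    simp [hqp]

theorem numDivisors_prime_pow_mul (hp : p.Prime) (h : p.Coprime m) :
    numDivisors (p ^ k * m) = (k + 1) * numDivisors m := by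
  rw [numDivisors, Nat.Coprime.card_divisors_mul (h.pow_left k), Nat.divisors_prime_pow hp]
  simp [numDivisors]

end nonCubicPart

/-- Cross-multiplied form of `S_e/S_1 = (τ(n_q)|3)/τ(n_q)`, valid also when `S_1` vanishes. Only
split primes with nonzero slope change the ratio, each by `(k+1|3)/(k+1)`. -/
theorem slopeSum_mul_numDivisors {e : AddChar (ZMod 3) ℂ} (he : e ≠ 1) {n : ℕ}
    (hn : Nat.gcd 6 n = 1) :
    slopeSum e n * numDivisors (nonCubicPart n) =
      legendreSym 3 (numDivisors (nonCubicPart n)) * slopeSum 1 n := by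
  induction n using Nat.recOnPrimePow with
  | zero => simp at hn
  | one =>
    have h : ∀ α ∈ normFiber 1, e (slopeModThree α) = 1 := fun α hα => by
      rw [mem_normFiber, Zsqrtd.norm_def] at hα
      have : α.im = 0 := by
        by_contra h
        have := Int.one_le_abs h
        push_cast at hα
        nlinarith [abs_mul_abs_self α.im, mul_self_nonneg α.re]
      simp [slopeModThree, this]
    have h1 : slopeSum e 1 = slopeSum 1 1 :=
      Finset.sum_congr rfl fun α hα => by rw [h α hα, AddChar.one_apply]
    simp [nonCubicPart_one, numDivisors, h1]
  | prime_pow_mul m p k hp hpm hk ih =>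
    have hcop : Nat.Coprime 6 (p ^ k * m) := hn
    have hm6 : Nat.Coprime 6 m := hcop.coprime_mul_left_right
    have hp6 : Nat.Coprime 6 p :=
      (Nat.coprime_pow_right_iff hk _ _).mp hcop.coprime_mul_right_right
    have hm0 : m ≠ 0 := by rintro rfl; simp at hm6
    have hp2 : p ≠ 2 := by rintro rfl; revert hp6; decide
    have hp3 : p ≠ 3 := by rintro rfl; revert hp6; decide
    have hm3 : ¬ 3 ∣ m := fun h => by
      have := Nat.dvd_gcd (by norm_num : 3 ∣ 6) h
      rw [hm6] at this
      omega
    specialize ih hm6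
    have hpmod := not_three_dvd_of_prime hp hp3
    rw [nonCubicPart_pow_mul hp hm0 hpm hk.ne']
    rcases (by omega : p % 3 = 1 ∨ p % 3 = 2) with h1 | h2
    · obtain ⟨α, hα, hα3⟩ := exists_norm_eq_prime hp h1
      have hα3' : slopeModThree α = 0 ↔ IsCubicResidue 2 p := by
        rw [slopeModThree_eq_zero_iff (by rw [hα]; exact_mod_cast hpmod), hα3]
      have ht := slopeSum_cubic_pow_mul (e := 1) hp hp2 hp3 hα (by simp) hm3 hpm k
      by_cases hres : IsCubicResidue 2 p
      · rw [if_neg (by tauto), one_mul, ht, slopeSum_cubic_pow_mul hp hp2 hp3 hα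
          (by rw [hα3'.mpr hres, AddChar.map_zero_eq_one]) hm3 hpm]
        linear_combination ((k + 1 : ℕ) : ℂ) * ih
      · rw [if_pos ⟨h1, hres⟩, ht, slopeSum_nonCubic_pow_mul he hp hp2 hp3 hα
          (mt hα3'.mp hres) hm3 hpm, numDivisors_prime_pow_mul hp (coprime_nonCubicPart hp hpm),
          Nat.cast_mul, Nat.cast_mul, legendreSym.mul, Int.cast_mul]
        linear_combination ((k + 1 : ℕ) : ℂ) * (legendreSym 3 (k + 1 : ℕ) : ℂ) * ih
    · rw [if_neg (fun h => by have := h.1; rw [Nat.ModEq] at this; omega), one_mul,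
        slopeSum_inert_pow_mul hp hp2 h2 hm3 hpm, slopeSum_inert_pow_mul hp hp2 h2 hm3 hpm]
      split_ifs
      · exact ih
      · simp

/-! ### From solution sets to elements of given norm -/

theorem finite_reprSet (n : ℕ) {a : ℕ} (ha : 0 < a) : (reprSet n a).Finite := by
  refine ((Set.finite_Icc (-n : ℤ) n).prod (Set.finite_Icc (-n : ℤ) n)).subset fun v hv => ?_
  have hv' : v.1 ^ 2 + (a : ℤ) * v.2 ^ 2 = n := hv
  have ha' : (1 : ℤ) ≤ a := by exact_mod_cast ha
  have h1 : v.2 ^ 2 ≤ (a : ℤ) * v.2 ^ 2 := le_mul_of_one_le_left (sq_nonneg _) ha'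
  simp only [Set.mem_prod, Set.mem_Icc]
  refine ⟨⟨?_, ?_⟩, ?_, ?_⟩ <;>
    nlinarith [Int.le_self_sq v.1, Int.le_self_sq (-v.1), Int.le_self_sq v.2,
      Int.le_self_sq (-v.2), sq_nonneg v.1, sq_nonneg v.2]

theorem ncard_reprSet_three (n : ℕ) : (reprSet n 3).ncard = (normFiber n).card := by
  rw [← Set.ncard_coe_finset]
  refine Set.ncard_congr (fun v _ => (⟨v.1, v.2⟩ : ℤ√(-3))) ?_ ?_ ?_
  · intro v hv
    have hv' : v.1 ^ 2 + ((3 : ℕ) : ℤ) * v.2 ^ 2 = n := hv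
    rw [Finset.mem_coe, mem_normFiber, Zsqrtd.norm_def, ← hv']
    push_cast; ring
  · intro v w _ _ h
    exact Prod.ext (congrArg Zsqrtd.re h) (congrArg Zsqrtd.im h)
  · intro α hα
    rw [Finset.mem_coe, mem_normFiber, Zsqrtd.norm_def] at hα
    refine ⟨(α.re, α.im), ?_, rfl⟩
    change α.re ^ 2 + ((3 : ℕ) : ℤ) * α.im ^ 2 = n
    rw [← hα]; push_cast; ring

theorem ncard_reprSet_twentySeven {n : ℕ} (hn : ¬ 3 ∣ n) :
    (reprSet n 27).ncard = ((normFiber n).filter (slopeModThree · = 0)).card := by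
  rw [← Set.ncard_coe_finset]
  have key : ∀ α : ℤ√(-3), α.norm = n → (slopeModThree α = 0 ↔ 3 ∣ α.im) := fun α hα =>
    slopeModThree_eq_zero_iff (by rw [hα]; exact_mod_cast hn)
  refine Set.ncard_congr (fun v _ => (⟨v.1, 3 * v.2⟩ : ℤ√(-3))) ?_ ?_ ?_
  · intro v hv
    have hv' : v.1 ^ 2 + ((27 : ℕ) : ℤ) * v.2 ^ 2 = n := hv
    have hnorm : (⟨v.1, 3 * v.2⟩ : ℤ√(-3)).norm = n := by
      rw [Zsqrtd.norm_def, ← hv']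
      push_cast; ring
    rw [Finset.mem_coe, Finset.mem_filter, mem_normFiber, key _ hnorm]
    exact ⟨hnorm, dvd_mul_right _ _⟩
  · intro v w _ _ h
    exact Prod.ext (congrArg Zsqrtd.re h)
      (mul_left_cancel₀ (by norm_num) (congrArg Zsqrtd.im h))
  · intro α hα
    rw [Finset.mem_coe, Finset.mem_filter, mem_normFiber] at hα
    obtain ⟨hnorm, h0⟩ := hα
    obtain ⟨c, hc⟩ := (key α hnorm).mp h0
    refine ⟨(α.re, c), ?_, Zsqrtd.ext rfl hc.symm⟩
    change α.re ^ 2 + ((27 : ℕ) : ℤ) * c ^ 2 = n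
    rw [← hnorm, Zsqrtd.norm_def, hc]; push_cast; ring

theorem slopeSum_one (n : ℕ) : slopeSum 1 n = (normFiber n).card := by
  simp [slopeSum]

theorem slopeSum_eq_sum_neg (e : AddChar (ZMod 3) ℂ) (n : ℕ) :
    slopeSum e n = ∑ α ∈ normFiber n, e (-slopeModThree α) := by
  refine Finset.sum_nbij' star star ?_ ?_ ?_ ?_ ?_
  · intro α hα; simpa [Zsqrtd.norm_conj] using hα
  · intro α hα; simpa [Zsqrtd.norm_conj] using hα
  · intro α _; simp
  · intro α _; simp
  · intro α _; rw [slopeModThree_star, neg_neg]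

/-- Orthogonality detects slope 0; conjugation negates slopes, so both nontrivial characters have
the same sum. -/
theorem three_mul_card_slope_eq_zero {e : AddChar (ZMod 3) ℂ} (he : e ≠ 1) (n : ℕ) :
    3 * (((normFiber n).filter (slopeModThree · = 0)).card : ℂ) =
      (normFiber n).card + 2 * slopeSum e n := by
  have h : ∑ α ∈ normFiber n, (1 + e (slopeModThree α) + e (-slopeModThree α)) =
      ∑ α ∈ normFiber n, if slopeModThree α = 0 then (3 : ℂ) else 0 :=
    Finset.sum_congr rfl fun α _ => AddChar.one_add_apply_add_apply_neg he _
  rw [Finset.sum_add_distrib, Finset.sum_add_distrib, ← slopeSum_eq_sum_neg, ← slopeSum,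
    ← Finset.sum_filter] at h
  simp only [Finset.sum_const, nsmul_eq_mul, mul_one] at h
  linear_combination -h

/-- Multiplication by `ω` permutes the elements of even norm, and shifts their slopes. -/
theorem three_mul_card_slope_eq_zero_of_even {n : ℕ} (h3 : ¬ 3 ∣ n) (h2 : 2 ∣ n) :
    3 * ((normFiber n).filter (slopeModThree · = 0)).card = (normFiber n).card := by
  -- This is multiplication by `ω = (-1 + √-3)/2`; even norm makes `x ≡ y` mod 2, so both halves are
  -- integers.
  let rot : ℤ√(-3) → ℤ√(-3) := fun α => ⟨(-α.re - 3 * α.im) / 2, (α.re - α.im) / 2⟩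
  have hrot : ∀ α : ℤ√(-3), α.norm = n →
      2 * (rot α).re = -α.re - 3 * α.im ∧ 2 * (rot α).im = α.re - α.im := by
    intro α hα
    have hpar : (2 : ℤ) ∣ α.re - α.im := by
      have hn : Even α.norm := by rw [hα]; exact_mod_cast even_iff_two_dvd.mpr h2
      rw [Zsqrtd.norm_def] at hn
      rw [← even_iff_two_dvd]
      have h : ¬ Even (-3 : ℤ) := by decide
      simp only [Int.even_sub, Int.even_mul, h, or_self, false_or] at hn ⊢
      exact hn
    constructor <;> simp only [rot] <;> omega
  -- Injectivity suffices: the inequalities run around the cycle `ℤ/3`, so all three classes have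
  -- equal size.
  have hle : ∀ c : ZMod 3, ((normFiber n).filter (slopeModThree · = c)).card ≤
      ((normFiber n).filter (slopeModThree · = c - 1)).card := by
    intro c
    refine Finset.card_le_card_of_injOn rot ?_ ?_
    · intro α hα
      rw [Finset.mem_coe, Finset.mem_filter, mem_normFiber] at hα ⊢
      obtain ⟨hnorm, rfl⟩ := hα
      obtain ⟨hre, him⟩ := hrot α hnorm
      refine ⟨?_, ?_⟩
      · rw [Zsqrtd.norm_def] at hnorm ⊢
        refine mul_left_cancel₀ (four_ne_zero (α := ℤ)) ?_
        linear_combination 4 * hnorm + (2 * (rot α).re + (-α.re - 3 * α.im)) * hre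
          + 3 * (2 * (rot α).im + (α.re - α.im)) * him
      -- As `1/2 = -1` mod 3, the image is `(x, y - x)`, of slope `xy - x² = xy - 1`.
      · have h30 : (3 : ZMod 3) = 0 := by decide
        have hsq := sq_re_eq_one (α := α) (by rw [hnorm]; exact_mod_cast h3)
        have hre' : 2 * ((rot α).re : ZMod 3) = -α.re - 3 * α.im := by
          simpa using congrArg (Int.cast : ℤ → ZMod 3) hre
        have him' : 2 * ((rot α).im : ZMod 3) = α.re - α.im := by
          simpa using congrArg (Int.cast : ℤ → ZMod 3) him
        have hre'' : ((rot α).re : ZMod 3) = α.re := by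
          linear_combination -hre' + ((rot α).re + α.im : ZMod 3) * h30
        have him'' : ((rot α).im : ZMod 3) = α.im - α.re := by
          linear_combination -him' + ((rot α).im : ZMod 3) * h30
        simp only [slopeModThree]
        push_cast
        rw [hre'', him'']
        linear_combination -hsq
    · intro α hα β hβ h
      rw [Finset.mem_coe, Finset.mem_filter, mem_normFiber] at hα hβ
      obtain ⟨h1, h2⟩ := hrot α hα.1
      obtain ⟨h3, h4⟩ := hrot β hβ.1
      have h5 := congrArg Zsqrtd.re h
      have h6 := congrArg Zsqrtd.im h
      ext <;> omega
  have hsum := Finset.card_eq_sum_card_fiberwise (s := normFiber n) (f := slopeModThree)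
    (t := Finset.univ) (fun _ _ => Finset.mem_coe.mpr (Finset.mem_univ _))
  rw [show (Finset.univ : Finset (ZMod 3)) = {0, 1, 2} by decide,
    Finset.sum_insert (by decide), Finset.sum_insert (by decide), Finset.sum_singleton] at hsum
  have h0 := hle 0
  have h1 := hle 1
  have h2 := hle 2
  rw [show (0 - 1 : ZMod 3) = 2 by decide] at h0
  rw [show (1 - 1 : ZMod 3) = 0 by decide] at h1
  rw [show (2 - 1 : ZMod 3) = 1 by decide] at h2
  omega

/-! ### Multiples of 3, and the final assembly -/

theorem three_dvd_fst_of_mem_reprSet {n : ℕ} (hn : 3 ∣ n) {v : ℤ × ℤ} (hv : v ∈ reprSet n 27) :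
    (3 : ℤ) ∣ v.1 := by
  have hv' : v.1 ^ 2 + ((27 : ℕ) : ℤ) * v.2 ^ 2 = n := hv
  obtain ⟨c, rfl⟩ := hn
  refine Int.prime_three.dvd_of_dvd_pow (n := 2) ⟨c - 9 * v.2 ^ 2, ?_⟩
  push_cast at hv'
  linear_combination hv'

theorem nine_dvd_of_mem_reprSet {n : ℕ} (hn : 3 ∣ n) {v : ℤ × ℤ} (hv : v ∈ reprSet n 27) :
    9 ∣ n := by
  obtain ⟨c, hc⟩ := three_dvd_fst_of_mem_reprSet hn hv
  have hv' : v.1 ^ 2 + ((27 : ℕ) : ℤ) * v.2 ^ 2 = n := hv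
  rw [hc] at hv'
  have : (9 : ℤ) ∣ n := ⟨c ^ 2 + 3 * v.2 ^ 2, by rw [← hv']; push_cast; ring⟩
  exact_mod_cast this

theorem ncard_reprSet_nine_mul (m : ℕ) : (reprSet (9 * m) 27).ncard = (reprSet m 3).ncard := by
  symm
  refine Set.ncard_congr (fun v _ => (3 * v.1, v.2)) ?_ ?_ ?_
  · intro v hv
    have hv' : v.1 ^ 2 + ((3 : ℕ) : ℤ) * v.2 ^ 2 = m := hv
    change (3 * v.1) ^ 2 + ((27 : ℕ) : ℤ) * v.2 ^ 2 = (9 * m : ℕ)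
    push_cast at hv' ⊢
    linear_combination 9 * hv'
  · intro v w _ _ h
    obtain ⟨h1, h2⟩ := Prod.mk.inj h
    exact Prod.ext (mul_left_cancel₀ (by norm_num) h1) h2
  · intro v hv
    obtain ⟨c, hc⟩ := three_dvd_fst_of_mem_reprSet (dvd_mul_of_dvd_left (by norm_num) m) hv
    refine ⟨(c, v.2), ?_, Prod.ext hc.symm rfl⟩
    have hv' : v.1 ^ 2 + ((27 : ℕ) : ℤ) * v.2 ^ 2 = (9 * m : ℕ) := hv
    change c ^ 2 + ((3 : ℕ) : ℤ) * v.2 ^ 2 = m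
    rw [hc] at hv'
    push_cast at hv' ⊢
    linarith

theorem theorem4p3 (n : ℕ) (hn : 0 < n) :
    (reprSet n 27).Finite ∧ (reprSet n 3).Finite ∧
    (3 ∣ n →
      ((reprSet n 27).Nonempty → 9 ∣ n) ∧
      (9 ∣ n →
        (reprSet (n / 9) 3).Finite ∧ (reprSet n 27).ncard = (reprSet (n / 9) 3).ncard)) ∧
    (¬ 3 ∣ n → 2 ∣ n →
      ((reprSet n 27).ncard : ℚ) = 1 / 3 * ((reprSet n 3).ncard : ℚ)) ∧
    (Nat.gcd 6 n = 1 →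
      ((reprSet n 27).ncard : ℚ) =
        1 / 3 *
          (1 + 2 * ((legendreSym 3 (numDivisors (nonCubicPart n) : ℤ) : ℚ) /
            (numDivisors (nonCubicPart n) : ℚ))) *
          ((reprSet n 3).ncard : ℚ)) := by
  refine ⟨finite_reprSet n (by norm_num), finite_reprSet n (by norm_num),
    fun h3 => ⟨fun ⟨v, hv⟩ => nine_dvd_of_mem_reprSet h3 hv, ?_⟩, fun h3 h2 => ?_, fun hgcd => ?_⟩
  · rintro ⟨m, rfl⟩
    rw [Nat.mul_div_cancel_left m (by norm_num)]
    exact ⟨finite_reprSet m (by norm_num), ncard_reprSet_nine_mul m⟩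
  · rw [ncard_reprSet_twentySeven h3, ncard_reprSet_three,
      ← three_mul_card_slope_eq_zero_of_even h3 h2]
    push_cast; ring
  · have h3 : ¬ 3 ∣ n := fun h => by
      have := Nat.dvd_gcd (by norm_num : 3 ∣ 6) h
      rw [hgcd] at this
      omega
    have he : (ZMod.stdAddChar : AddChar (ZMod 3) ℂ) ≠ 1 := fun h => by
      have h1 : (ZMod.stdAddChar (1 : ZMod 3) : ℂ) = ZMod.stdAddChar (0 : ZMod 3) := by
        rw [h]; simp
      exact absurd (ZMod.injective_stdAddChar h1) (by decide)
    have hT := slopeSum_mul_numDivisors he hgcd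
    have hc := three_mul_card_slope_eq_zero he n
    rw [slopeSum_one] at hT
    have hpos : (numDivisors (nonCubicPart n) : ℂ) ≠ 0 := by
      rw [Nat.cast_ne_zero, numDivisors, Finset.card_ne_zero]
      exact ⟨1, Nat.one_mem_divisors.mpr nonCubicPart_ne_zero⟩
    rw [ncard_reprSet_twentySeven h3, ncard_reprSet_three]
    -- The character sums are complex, so the rational identity is checked in `ℂ`.
    apply (Rat.cast_injective (α := ℂ))
    push_cast
    field_simp
    linear_combination (numDivisors (nonCubicPart n) : ℂ) * hc + 2 * hT
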